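/- **Setting.** Let $\mathcal M_d=\mathbb C^{d\times d}$ and let $\mathcal A_d^+$ be the set of positive definite matrices in $\mathcal M_d$. Let $\mathcal L:\mathcal M_d\to\mathcal M_d$ be a Liouvillian (Heisenberg picture), i.e. a map of the form $$\mathcal L(f)=i[H,f]+\sum_i\Big(L_i^\dagger fL_i-\tfrac12\{L_i^\dagger L_i,f\}\Big),\qquad H=H^\dagger,$$ with finitely many $L_i\in\mathcal M_d$, and let $T_t=e^{t\mathcal L}$. Assume that $\mathcal L$ is primitive with stationary state $\sigma$: $\sigma$ is a positive definite density matrix with $\mathcal L^*(\sigma)=0$ ($\mathcal L^*$ is the Hilbert–Schmidt dual of $\mathcal L$), and $\sigma$ is the only density matrix in the kernel of $\mathcal L^*$. For real $s$ put $\Gamma_\sigma^s(f)=\sigma^{s/2}f\sigma^{s/2}$ and $\Gamma_\sigma=\Gamma_\sigma^1$. For Hermitian $f,g$ put $\langle f,g\rangle_\sigma=\mathrm{tr}(\Gamma_\sigma(f)g)$ and $\|f\|_{p,\sigma}=\big(\mathrm{tr}\,|\Gamma_\sigma^{1/p}(f)|^p\big)^{1/p}$. For $f\in\mathcal A_d^+$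 and exponents $p,q$ put $$I_{p,q}(f)=\Gamma_\sigma^{-1/p}\big[\,|\Gamma_\sigma^{1/q}(f)|^{q/p}\,\big],\qquad S_p(f)=\Gamma_\sigma^{-1/p}\big[\Gamma_\sigma^{1/p}(f)\log\Gamma_\sigma^{1/p}(f)\big]-\tfrac1{2p}\{f,\log\sigma\},$$ and, with $1/p+1/q=1$, $$\mathrm{Ent}_p(f)=\langle I_{q,p}(f),S_p(f)\rangle_\sigma-\|f\|_{p,\sigma}^p\log\|f\|_{p,\sigma},\qquad \mathcal E_p(f)=-\frac{p}{2(p-1)}\langle I_{q,p}(f),\mathcal L(f)\rangle_\sigma\quad(p>1),$$ $$\mathcal E_1(f)=\lim_{p\to1}\mathcal E_p(f)=-\tfrac12\,\mathrm{tr}\big(\Gamma_\sigma(\mathcal L(f))(\log\Gamma_\sigma(f)-\log\sigma)\big).$$ * $LS_2$ holds with constant $a>0$ if $a\,\mathrm{Ent}_2(f)\le\mathcal E_2(f)$ for all $f\in\mathcal A_d^+$. The $LS_2$ constant $\alpha_2$ of $\mathcal L$ is the largest such $a$ ($+\infty$ when $d=1$). * $\mathcal L$ is weakly $\mathbb L_p$-regular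 if for all $f\in\mathcal A_d^+$: $\mathcal E_p(f)\ge\mathcal E_2(I_{2,p}(f))$ for $1\le p\le2$, and $\mathcal E_p(f)\ge\frac1{p-1}\mathcal E_2(I_{2,p}(f))$ for $p\ge2$. * $\mathcal L$ is strongly $\mathbb L_p$-regular if $\mathcal E_p(f)\ge\frac2p\,\mathcal E_2(I_{2,p}(f))$ for all $p\ge1$ and all $f\in\mathcal A_d^+$. **Theorem.** 1. Let $\alpha>0$. If $\|T_t(f)\|_{p,\sigma}\le\|f\|_{2,\sigma}$ for all $t>0$, all $p$ with $2\le p\le1+e^{2\alpha t}$ and all $f\in\mathcal A_d^+$, then $LS_2$ holds with constant $\alpha$; in particular the $LS_2$ constant satisfies $\alpha_2\ge\alpha$. 2. Let $\alpha_2>0$ be a constant with which $LS_2$ holds (for instance the $LS_2$ constant, when it is finite). If $\mathcal L$ is weakly $\mathbb L_p$-regular, then $\|T_t(f)\|_{p,\sigma}\le\|f\|_{2,\sigma}$ for all $t>0$, all $p$ with $2\le p\le1+e^{\alpha_2t}$ and all $f\in\mathcal A_d^+$. If $\mathcal L$ is strongly $\mathbb L_p$-regular, then the same holds for all $p$ with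 $2\le p\le1+e^{2\alpha_2t}$. -/

import Mathlib

open scoped ComplexOrder

noncomputable section

/-- The algebra of complex `d × d` matrices. -/
abbrev Mat (d : ℕ) : Type := Matrix (Fin d) (Fin d) ℂ

/-- The real power `A ^ s` of a positive definite matrix (functional calculus of a Hermitian
matrix; the spectrum is finite, so every real function may be applied). -/
def matPow {d : ℕ} (A : Mat d) (s : ℝ) : Mat d := cfc (fun x : ℝ => x ^ s) A

/-- `|X| ^ s` for a Hermitian matrix `X`. -/
def absPow {d : ℕ} (X : Mat d) (s : ℝ) : Mat d := cfc (fun x : ℝ => |x| ^ s) X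

/-- The logarithm of a positive definite matrix. -/
def matLog {d : ℕ} (A : Mat d) : Mat d := cfc Real.log A

/-- States (density matrices). -/
def IsState {d : ℕ} (ρ : Mat d) : Prop := ρ.PosSemidef ∧ ρ.trace = 1

/-- `Γ_σ^s (f) = σ^{s/2} f σ^{s/2}`. -/
def Gam {d : ℕ} (σ : Mat d) (s : ℝ) (f : Mat d) : Mat d :=
  matPow σ (s / 2) * f * matPow σ (s / 2)

/-- The weighted norm `‖f‖_{p,σ} = (tr |Γ_σ^{1/p}(f)|^p)^{1/p}` of a Hermitian matrix `f`. -/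
def lpNorm {d : ℕ} (σ : Mat d) (p : ℝ) (f : Mat d) : ℝ :=
  ((absPow (Gam σ (1 / p) f) p).trace.re) ^ (1 / p)

/-- The weighted inner product `⟨f, g⟩_σ = tr (Γ_σ(f) g)` of Hermitian matrices; the trace is then
a real number. -/
def wInner {d : ℕ} (σ f g : Mat d) : ℝ := (Gam σ 1 f * g).trace.re

/-- The power operator `I_{p,q}(f) = Γ_σ^{-1/p} ( |Γ_σ^{1/q}(f)|^{q/p} )`. -/
def powOp {d : ℕ} (σ : Mat d) (p q : ℝ) (f : Mat d) : Mat d :=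
  Gam σ (-(1 / p)) (absPow (Gam σ (1 / q) f) (q / p))

/-- The operator valued relative entropy
`S_p(f) = Γ_σ^{-1/p} ( Γ_σ^{1/p}(f) log Γ_σ^{1/p}(f) ) - (1/2p) {f, log σ}`. -/
def opEntropy {d : ℕ} (σ : Mat d) (p : ℝ) (f : Mat d) : Mat d :=
  Gam σ (-(1 / p)) (Gam σ (1 / p) f * matLog (Gam σ (1 / p) f))
    - (1 / (2 * p) : ℝ) • (f * matLog σ + matLog σ * f)

/-- The relative entropy `Ent_p(f) = ⟨I_{q,p}(f), S_p(f)⟩_σ - ‖f‖_{p,σ}^p log ‖f‖_{p,σ}`, where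
`q = p / (p - 1)` is the conjugate exponent of `p`. (For `p = 1` the conventions for division by
zero give `1/q = p/q = 0`, so that `I_{∞,1}(f)` is the identity matrix, as it should be.) -/
def relEnt {d : ℕ} (σ : Mat d) (p : ℝ) (f : Mat d) : ℝ :=
  wInner σ (powOp σ (p / (p - 1)) p f) (opEntropy σ p f)
    - lpNorm σ p f ^ p * Real.log (lpNorm σ p f)

/-- `L` is a Liouvillian (Heisenberg picture): it has a Lindblad form
`L(f) = i[H, f] + ∑ᵢ (Lᵢ† f Lᵢ - ½ {Lᵢ† Lᵢ, f})` with `H` Hermitian. -/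
def IsLiouvillian {d : ℕ} (L : Mat d →ₗ[ℂ] Mat d) : Prop :=
  ∃ (H : Mat d) (m : ℕ) (K : Fin m → Mat d), H.IsHermitian ∧
    ∀ f : Mat d, L f = Complex.I • (H * f - f * H) +
      ∑ i, ((K i).conjTranspose * f * K i
        - (1 / 2 : ℂ) • ((K i).conjTranspose * K i * f + f * ((K i).conjTranspose * K i)))

/-- `L^*(ρ) = 0`, where `L^*` is the dual of `L` for the Hilbert-Schmidt pairing:
`tr (L^*(ρ) f) = tr (ρ L(f))` for all `f`. -/
def IsStationaryFor {d : ℕ} (L : Mat d →ₗ[ℂ] Mat d) (ρ : Mat d) : Prop :=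
  ∀ f : Mat d, (ρ * L f).trace = 0

/-- `L` is primitive with stationary state `σ`: `σ` is a full-rank stationary state and there is no
other stationary state. -/
def IsPrimitiveWith {d : ℕ} (L : Mat d →ₗ[ℂ] Mat d) (σ : Mat d) : Prop :=
  IsState σ ∧ σ.PosDef ∧ IsStationaryFor L σ ∧ ∀ ρ : Mat d, IsState ρ → IsStationaryFor L ρ → ρ = σ

section Semigroup

open scoped Matrix.Norms.L2Operator

/-- The semigroup `T_t = exp (t L)` (the norm only serves to provide the topology). -/
def semigroup {d : ℕ} (L : Mat d →ₗ[ℂ] Mat d) (t : ℝ) : Mat d →L[ℂ] Mat d :=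
  NormedSpace.exp ((t : ℂ) • LinearMap.toContinuousLinearMap L)

end Semigroup

/-- The Dirichlet form `E_p(f) = - p / (2 (p - 1)) ⟨I_{q,p}(f), L(f)⟩_σ` with `q = p / (p - 1)`;
for `p = 1` it is the limit `-½ tr (Γ_σ(L f) (log Γ_σ(f) - log σ))` of these as `p → 1`. -/
def dirichlet {d : ℕ} (L : Mat d →ₗ[ℂ] Mat d) (σ : Mat d) (p : ℝ) (f : Mat d) : ℝ :=
  if p = 1 then
    -(1 / 2) * (Gam σ 1 (L f) * (matLog (Gam σ 1 f) - matLog σ)).trace.re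
  else
    -p / (2 * (p - 1)) * wInner σ (powOp σ (p / (p - 1)) p f) (L f)

/-- Weak regularity: for all positive definite `f`, `E_p(f) ≥ E_2(I_{2,p}(f))` if `1 ≤ p ≤ 2` and
`E_p(f) ≥ (p - 1)⁻¹ E_2(I_{2,p}(f))` if `p ≥ 2`. -/
def IsWeaklyRegular {d : ℕ} (L : Mat d →ₗ[ℂ] Mat d) (σ : Mat d) : Prop :=
  ∀ p : ℝ, ∀ f : Mat d, f.PosDef →
    (1 ≤ p → p ≤ 2 → dirichlet L σ 2 (powOp σ 2 p f) ≤ dirichlet L σ p f) ∧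
    (2 ≤ p → (p - 1)⁻¹ * dirichlet L σ 2 (powOp σ 2 p f) ≤ dirichlet L σ p f)

/-- Strong regularity: `E_p(f) ≥ (2/p) E_2(I_{2,p}(f))` for all `p ≥ 1` and all positive
definite `f`. -/
def IsStronglyRegular {d : ℕ} (L : Mat d →ₗ[ℂ] Mat d) (σ : Mat d) : Prop :=
  ∀ p : ℝ, 1 ≤ p → ∀ f : Mat d, f.PosDef →
    2 / p * dirichlet L σ 2 (powOp σ 2 p f) ≤ dirichlet L σ p f

/-- The logarithmic Sobolev inequality `LS_p` with the positive constant `a`: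
`a Ent_p(f) ≤ E_p(f)` for all positive definite `f`. -/
def SatisfiesLSWith {d : ℕ} (L : Mat d →ₗ[ℂ] Mat d) (σ : Mat d) (p a : ℝ) : Prop :=
  0 < a ∧ ∀ f : Mat d, f.PosDef → a * relEnt σ p f ≤ dirichlet L σ p f

/-- The optimal constant in `LS_p`. It is an extended real number because in dimension one, where
`Ent_p` and `E_p` vanish, every positive constant is admissible. -/
def logSobolevConstant {d : ℕ} (L : Mat d →ₗ[ℂ] Mat d) (σ : Mat d) (p : ℝ) : EReal :=
  sSup {x : EReal | ∃ a : ℝ, SatisfiesLSWith L σ p a ∧ x = (a : EReal)}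

/-- Hypercontractivity from the exponent `2`, at rate `c`: for all `t > 0` and all `p` with
`2 ≤ p ≤ 1 + exp (c t)`, `‖T_t f‖_{p,σ} ≤ ‖f‖_{2,σ}` for all positive definite `f`. -/
def IsHypercontractive {d : ℕ} (L : Mat d →ₗ[ℂ] Mat d) (σ : Mat d) (c : ℝ) : Prop :=
  ∀ t : ℝ, 0 < t → ∀ p : ℝ, 2 ≤ p → p ≤ 1 + Real.exp (c * t) →
    ∀ f : Mat d, f.PosDef → lpNorm σ p (semigroup L t f) ≤ lpNorm σ 2 f

end

/-!
Along the semigroup, with `p(s) = 1 + exp (c s)` and `f_s = T_s f`, the derivative of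
`log ‖f_s‖_{p(s),σ}` is a positive multiple of `c Ent_p(f_s) - 2 E_p(f_s)`
(`hasDerivAt_log_lpNorm_semigroup`). At `s = 0`, where `p = 2`, hypercontractivity at rate
`c = 2α` forces this to be nonpositive, which is the inequality `LS_2`. Conversely,
`I_{2,p}` carries `Ent_p` to `Ent_2` up to the factor `p / 2` (`relEnt_two_powOp`), so `LS_2` and
regularity bound `Ent_p` by `E_p` for every `p ≥ 2`, and the logarithm of the norm decreases. For a
final exponent below the largest admissible one the rate `c` is lowered; this uses `Ent_p ≥ 0`
(`relEnt_nonneg`), which is Klein's inequality.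

The analytic point is the derivative of `tr |X_s| ^ {p(s)}` for a curve of matrices that do not
commute with each other (`hasDerivAt_trace_absPow`). If `P_i` and `Q_j` are the spectral
projections of `A` and `B`, then `tr f(A) g(B) = ∑ f(a_i) g(b_j) tr(P_i Q_j)` with nonnegative
weights, so that an inequality `∑_k f_k(a) g_k(b) ≥ 0` between scalars gives
`∑_k tr f_k(A) g_k(B) ≥ 0`. Applied to the second order Taylor estimate of `(p, x) ↦ x ^ p` this
bounds the remainder of the trace function by `(p - p₀)² + tr (B - A)²`
(`exists_abs_trace_absPow_sub_le`), without perturbation theory of eigenvalues; applied to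
`x log x` it gives Klein's inequality.

The norm is only differentiated at positive definite matrices, and the semigroup preserves these
(`semigroup_posDef`): at a first time where the quadratic form of `T_t f` vanished on a vector, the
Lindblad form of the generator would make its derivative nonnegative, and strictly positive after
adding a small drift.
-/

noncomputable section

/-! ### Spectral decomposition and overlaps of eigenvectors -/

/-- The rank one projection onto the line spanned by the `i`-th eigenvector of a Hermitian
matrix. -/
def eigenProj {d : ℕ} {A : Mat d} (hA : A.IsHermitian) (i : Fin d) : Mat d :=
  (hA.eigenvectorUnitary : Mat d) * Matrix.single i i 1 * star (hA.eigenvectorUnitary : Mat d)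

section Spectral

variable {d : ℕ} {A B : Mat d}

lemma eigenProj_mul (hA : A.IsHermitian) (i j : Fin d) :
    eigenProj hA i * eigenProj hA j = if i = j then eigenProj hA i else 0 := by
  have h : star (hA.eigenvectorUnitary : Mat d) * (hA.eigenvectorUnitary : Mat d) = 1 :=
    Unitary.coe_star_mul_self _
  have key : eigenProj hA i * eigenProj hA j =
      (hA.eigenvectorUnitary : Mat d) * (Matrix.single i i 1 * Matrix.single j j 1) *
        star (hA.eigenvectorUnitary : Mat d) := by
    simp only [eigenProj, mul_assoc]
    rw [← mul_assoc (star (hA.eigenvectorUnitary : Mat d)), h, one_mul]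
  rw [key]
  split_ifs with hij
  · subst hij
    simp [eigenProj]
  · rw [Matrix.single_mul_single_of_ne _ _ _ _ hij, mul_zero, zero_mul]

lemma eigenProj_conjTranspose (hA : A.IsHermitian) (i : Fin d) :
    (eigenProj hA i).conjTranspose = eigenProj hA i := by
  simp [eigenProj, Matrix.conjTranspose_mul, Matrix.star_eq_conjTranspose, mul_assoc]

lemma sum_eigenProj (hA : A.IsHermitian) : ∑ i, eigenProj hA i = 1 := by
  simp only [eigenProj]
  rw [← Finset.sum_mul, ← Finset.mul_sum, Matrix.sum_single_one, mul_one]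
  exact Unitary.coe_mul_star_self _

lemma trace_eigenProj (hA : A.IsHermitian) (i : Fin d) : (eigenProj hA i).trace = 1 := by
  rw [eigenProj, Matrix.trace_mul_comm, ← mul_assoc, Unitary.coe_star_mul_self, one_mul]
  simp

lemma cfc_eq_sum_eigenProj (hA : A.IsHermitian) (g : ℝ → ℝ) :
    cfc g A = ∑ i, g (hA.eigenvalues i) • eigenProj hA i := by
  have h : Matrix.diagonal ((RCLike.ofReal : ℝ → ℂ) ∘ g ∘ hA.eigenvalues) =
      ∑ i, g (hA.eigenvalues i) • Matrix.single i i (1 : ℂ) := by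
    ext k l
    simp only [Matrix.sum_apply, Matrix.smul_apply, Matrix.single_apply, Matrix.diagonal_apply]
    by_cases hkl : k = l
    · subst hkl
      simp
    · rw [if_neg hkl, Finset.sum_eq_zero]
      rintro i -
      rw [if_neg (fun h => hkl (h.1.symm.trans h.2)), smul_zero]
  rw [hA.cfc_eq, Matrix.IsHermitian.cfc, Unitary.conjStarAlgAut_apply, h, Finset.mul_sum,
    Finset.sum_mul]
  refine Finset.sum_congr rfl fun i _ => ?_
  rw [eigenProj, mul_smul_comm, smul_mul_assoc]

lemma cfc_one_of_isHermitian (hA : A.IsHermitian) : cfc (fun _ : ℝ => (1 : ℝ)) A = 1 := by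
  simp [cfc_eq_sum_eigenProj hA, sum_eigenProj]

lemma cfc_eq_self_of_isHermitian (hA : A.IsHermitian) : cfc (fun x : ℝ => x) A = A :=
  cfc_id' ℝ A hA

lemma cfc_congr_eigenvalues (hA : A.IsHermitian) {f g : ℝ → ℝ}
    (h : ∀ i, f (hA.eigenvalues i) = g (hA.eigenvalues i)) : cfc f A = cfc g A := by
  simp [cfc_eq_sum_eigenProj hA, h]

/-- For a Hermitian matrix every real function may be used in the functional calculus, because the
spectrum is finite; so products need no continuity hypothesis. -/
lemma cfc_mul_cfc (hA : A.IsHermitian) (f g : ℝ → ℝ) :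
    cfc f A * cfc g A = cfc (fun x => f x * g x) A := by
  simp only [cfc_eq_sum_eigenProj hA, Finset.sum_mul_sum, smul_mul_smul_comm, eigenProj_mul]
  simp

lemma smul_cfc (hA : A.IsHermitian) (c : ℝ) (f : ℝ → ℝ) :
    c • cfc f A = cfc (fun x => c * f x) A := by
  simp only [cfc_eq_sum_eigenProj hA, Finset.smul_sum, mul_smul]

lemma isHermitian_cfc (hA : A.IsHermitian) (f : ℝ → ℝ) : (cfc f A).IsHermitian := by
  rw [cfc_eq_sum_eigenProj hA, Matrix.IsHermitian, Matrix.conjTranspose_sum]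
  simp [eigenProj_conjTranspose]

/-- The squared modulus of the inner product of an eigenvector of `A` and an eigenvector
of `B`. -/
def eigenOverlap (hA : A.IsHermitian) (hB : B.IsHermitian) (i j : Fin d) : ℝ :=
  (eigenProj hA i * eigenProj hB j).trace.re

lemma eigenOverlap_nonneg (hA : A.IsHermitian) (hB : B.IsHermitian) (i j : Fin d) :
    0 ≤ eigenOverlap hA hB i j := by
  have hP : eigenProj hA i * eigenProj hA i = eigenProj hA i := by simp [eigenProj_mul]
  have hQ : eigenProj hB j * eigenProj hB j = eigenProj hB j := by simp [eigenProj_mul]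
  have h : (eigenProj hA i * eigenProj hB j).trace =
      ((eigenProj hA i * eigenProj hB j).conjTranspose *
        (eigenProj hA i * eigenProj hB j)).trace := by
    rw [Matrix.conjTranspose_mul, eigenProj_conjTranspose, eigenProj_conjTranspose, mul_assoc,
      ← mul_assoc (eigenProj hA i), hP,
      Matrix.trace_mul_comm (eigenProj hB j), mul_assoc, hQ]
  have h0 := (Matrix.posSemidef_conjTranspose_mul_self
    (eigenProj hA i * eigenProj hB j)).trace_nonneg
  rw [← h] at h0
  exact (Complex.le_def.1 h0).1

lemma sum_eigenOverlap_left (hA : A.IsHermitian) (hB : B.IsHermitian) (j : Fin d) :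
    ∑ i, eigenOverlap hA hB i j = 1 := by
  simp only [eigenOverlap]
  rw [← Complex.re_sum, ← Matrix.trace_sum, ← Finset.sum_mul, sum_eigenProj, one_mul,
    trace_eigenProj, Complex.one_re]

/-- Mixed traces are weighted sums over pairs of eigenvalues. Scalar inequalities between sums of
products `f(a) g(b)` thereby become trace inequalities. -/
lemma trace_cfc_mul_cfc_re (hA : A.IsHermitian) (hB : B.IsHermitian) (f g : ℝ → ℝ) :
    (cfc f A * cfc g B).trace.re = ∑ i, ∑ j,
      f (hA.eigenvalues i) * g (hB.eigenvalues j) * eigenOverlap hA hB i j := by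
  simp only [cfc_eq_sum_eigenProj hA, cfc_eq_sum_eigenProj hB, Finset.sum_mul_sum,
    smul_mul_smul_comm, Matrix.trace_sum, Matrix.trace_smul, Complex.re_sum, Complex.smul_re,
    eigenOverlap, smul_eq_mul]

lemma trace_cfc_left_re (hA : A.IsHermitian) (hB : B.IsHermitian) (f : ℝ → ℝ) :
    (cfc f A).trace.re = ∑ i, ∑ j, f (hA.eigenvalues i) * eigenOverlap hA hB i j := by
  have h := trace_cfc_mul_cfc_re hA hB f (fun _ => 1)
  rw [cfc_one_of_isHermitian hB, mul_one] at h
  simpa using h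

lemma trace_cfc_right_re (hA : A.IsHermitian) (hB : B.IsHermitian) (g : ℝ → ℝ) :
    (cfc g B).trace.re = ∑ i, ∑ j, g (hB.eigenvalues j) * eigenOverlap hA hB i j := by
  have h := trace_cfc_mul_cfc_re hA hB (fun _ => 1) g
  rw [cfc_one_of_isHermitian hA, one_mul] at h
  simpa using h

/-- `tr (B - A)²` is the sum of the squared differences of eigenvalues of `A` and `B`, weighted by
the overlaps. -/
lemma trace_sub_sq_re (hA : A.IsHermitian) (hB : B.IsHermitian) :
    ((B - A) * (B - A)).trace.re = ∑ i, ∑ j,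
      (hB.eigenvalues j - hA.eigenvalues i) ^ 2 * eigenOverlap hA hB i j := by
  have h1 := trace_cfc_left_re hA hB (fun x => x * x)
  have h2 := trace_cfc_right_re hA hB (fun x => x * x)
  have h3 := trace_cfc_mul_cfc_re hA hB (fun x => x) (fun x => x)
  rw [← cfc_mul_cfc hA, cfc_eq_self_of_isHermitian hA] at h1
  rw [← cfc_mul_cfc hB, cfc_eq_self_of_isHermitian hB] at h2
  rw [cfc_eq_self_of_isHermitian hA, cfc_eq_self_of_isHermitian hB] at h3
  have h4 : ((B - A) * (B - A)).trace = (A * A).trace + (B * B).trace - 2 * (A * B).trace := by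
    simp only [sub_mul, mul_sub, Matrix.trace_sub]
    rw [Matrix.trace_mul_comm B A]
    ring
  have h5 : ((B - A) * (B - A)).trace.re =
      (A * A).trace.re + (B * B).trace.re - 2 * (A * B).trace.re := by
    rw [h4]; simp
  rw [h5, h1, h2, h3, Finset.mul_sum, ← Finset.sum_add_distrib, ← Finset.sum_sub_distrib]
  refine Finset.sum_congr rfl fun i _ => ?_
  rw [Finset.mul_sum, ← Finset.sum_add_distrib, ← Finset.sum_sub_distrib]
  exact Finset.sum_congr rfl fun j _ => by ring

/-- Every eigenvalue of `B` is close to some eigenvalue of `A` if `tr (B - A)²` is small. -/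
lemma exists_abs_eigenvalues_sub_lt (hA : A.IsHermitian) (hB : B.IsHermitian) {ε : ℝ}
    (hε : 0 < ε) (h : ((B - A) * (B - A)).trace.re < ε ^ 2) (j : Fin d) :
    ∃ i, |hB.eigenvalues j - hA.eigenvalues i| < ε := by
  by_contra! hc
  rw [trace_sub_sq_re hA hB, Finset.sum_comm] at h
  refine absurd h (not_lt.2 ?_)
  have hnn : ∀ j i, 0 ≤ (hB.eigenvalues j - hA.eigenvalues i) ^ 2 * eigenOverlap hA hB i j :=
    fun j i => mul_nonneg (sq_nonneg _) (eigenOverlap_nonneg hA hB i j)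
  calc ε ^ 2 = ∑ i, ε ^ 2 * eigenOverlap hA hB i j := by
        rw [← Finset.mul_sum, sum_eigenOverlap_left, mul_one]
    _ ≤ ∑ i, (hB.eigenvalues j - hA.eigenvalues i) ^ 2 * eigenOverlap hA hB i j := by
        refine Finset.sum_le_sum fun i _ =>
          mul_le_mul_of_nonneg_right ?_ (eigenOverlap_nonneg hA hB i j)
        rw [← sq_abs (_ - _)]
        exact pow_le_pow_left₀ hε.le (hc i) 2
    _ ≤ _ := Finset.single_le_sum
        (f := fun j => ∑ i, (hB.eigenvalues j - hA.eigenvalues i) ^ 2 * eigenOverlap hA hB i j)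
        (fun j _ => Finset.sum_nonneg fun i _ => hnn j i) (Finset.mem_univ j)

end Spectral

/-! ### Klein inequality and differentiation of trace functions -/

/-- Quadratic Taylor remainder, uniformly on a compact convex set. -/
lemma exists_abs_sub_sub_fderiv_le {E : Type*} [NormedAddCommGroup E] [NormedSpace ℝ E]
    {f : E → ℝ} {U s : Set E} (hU : IsOpen U) (hf : ContDiffOn ℝ 2 f U) (hs : IsCompact s)
    (hconv : Convex ℝ s) (hsU : s ⊆ U) :
    ∃ C : ℝ, 0 ≤ C ∧ ∀ x ∈ s, ∀ y ∈ s, |f y - f x - fderiv ℝ f x (y - x)| ≤ C * ‖y - x‖ ^ 2 := by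
  have hf' : ContDiffOn ℝ 1 (fderiv ℝ f) U := hf.fderiv_of_isOpen hU (by norm_num)
  obtain ⟨K, hK⟩ := (hf'.mono hsU).exists_lipschitzOnWith one_ne_zero hconv hs
  refine ⟨K, K.2, fun x hx y hy => ?_⟩
  have hseg : segment ℝ x y ⊆ s := hconv.segment_subset hx hy
  have hder : ∀ z ∈ segment ℝ x y, HasFDerivWithinAt f (fderiv ℝ f z) (segment ℝ x y) z :=
    fun z hz => ((hf.differentiableOn (by norm_num)).differentiableAt
      (hU.mem_nhds (hsU (hseg hz)))).hasFDerivAt.hasFDerivWithinAt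
  have hb : ∀ z ∈ segment ℝ x y, ‖fderiv ℝ f z - fderiv ℝ f x‖ ≤ K * ‖y - x‖ := by
    intro z hz
    refine (hK.norm_sub_le (hseg hz) hx).trans ?_
    exact mul_le_mul_of_nonneg_left (norm_sub_le_of_mem_segment hz) K.2
  have := (convex_segment x y).norm_image_sub_le_of_norm_hasFDerivWithin_le' hder hb
    (left_mem_segment ℝ x y) (right_mem_segment ℝ x y)
  rw [Real.norm_eq_abs] at this
  calc _ ≤ _ := this
    _ = _ := by ring

/-- The Taylor remainder of `(p, x) ↦ x ^ p` at `(p₀, a)` is quadratic, uniformly for `a` in a compact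
interval of positive numbers. -/
lemma exists_abs_rpow_sub_le (p₀ m M : ℝ) (hm : 0 < m) :
    ∃ C : ℝ, 0 ≤ C ∧ ∀ p ∈ Set.Icc (p₀ - 1) (p₀ + 1), ∀ a ∈ Set.Icc m M, ∀ b ∈ Set.Icc m M,
      |b ^ p - a ^ p₀ - (p - p₀) * (a ^ p₀ * Real.log a) - p₀ * (a ^ (p₀ - 1) * (b - a))| ≤
        C * ((p - p₀) ^ 2 + (b - a) ^ 2) := by
  have hU : IsOpen {z : ℝ × ℝ | 0 < z.1} := isOpen_lt continuous_const continuous_fst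
  have hf : ContDiffOn ℝ 2 (fun z : ℝ × ℝ => z.1 ^ z.2) {z : ℝ × ℝ | 0 < z.1} :=
    fun z hz => (contDiffAt_fst.rpow contDiffAt_snd (ne_of_gt hz)).contDiffWithinAt
  obtain ⟨C, hC, h⟩ := exists_abs_sub_sub_fderiv_le hU hf
    (isCompact_Icc.prod isCompact_Icc : IsCompact (Set.Icc m M ×ˢ Set.Icc (p₀ - 1) (p₀ + 1)))
    ((convex_Icc _ _).prod (convex_Icc _ _)) (fun z hz => lt_of_lt_of_le hm hz.1.1)
  refine ⟨C, hC, fun p hp a ha b hb => ?_⟩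
  have ha0 : 0 < a := lt_of_lt_of_le hm ha.1
  have hx := h (a, p₀) ⟨ha, by constructor <;> linarith⟩ (b, p) ⟨hb, hp⟩
  rw [(Real.hasStrictFDerivAt_rpow_of_pos (a, p₀) ha0).hasFDerivAt.fderiv] at hx
  simp only [Prod.mk_sub_mk] at hx
  have hn : ‖((b - a, p - p₀) : ℝ × ℝ)‖ ^ 2 ≤ (p - p₀) ^ 2 + (b - a) ^ 2 := by
    rw [Prod.norm_def]
    rcases max_cases ‖b - a‖ ‖p - p₀‖ with h | h <;> rw [h.1, Real.norm_eq_abs, sq_abs] <;>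
      nlinarith [sq_nonneg (b - a), sq_nonneg (p - p₀)]
  refine le_trans (le_of_eq ?_) (hx.trans (mul_le_mul_of_nonneg_left hn hC))
  congr 1
  simp
  ring

section Klein

variable {d : ℕ} {A B : Mat d}

/-- Klein's inequality for `x log x`, for a second argument of trace one. -/
lemma trace_mul_log_trace_le (hA : A.PosDef) (hB : B.PosDef) (hB1 : B.trace = 1) :
    A.trace.re * Real.log A.trace.re ≤
      (cfc (fun x => x * Real.log x) A).trace.re - (A * matLog B).trace.re := by
  rcases isEmpty_or_nonempty (Fin d) with he | hne
  · simp [Matrix.trace] at hB1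
  have hτ : 0 < A.trace.re := (Complex.lt_def.1 hA.trace_pos).1
  set τ := A.trace.re with hτdef
  have e1 := trace_cfc_left_re hA.1 hB.1 (fun x => x * Real.log x)
  have e2 := trace_cfc_mul_cfc_re hA.1 hB.1 (fun x => x) Real.log
  have e3 := trace_cfc_left_re hA.1 hB.1 (fun x => x)
  have e4 := trace_cfc_right_re hA.1 hB.1 (fun x => x)
  rw [cfc_eq_self_of_isHermitian hA.1] at e2 e3
  rw [cfc_eq_self_of_isHermitian hB.1, hB1, Complex.one_re] at e4
  -- the pointwise inequality is `log x ≤ x - 1` at `x = τ b / a`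
  have key : 0 ≤ ∑ i, ∑ j, (hA.1.eigenvalues i * Real.log (hA.1.eigenvalues i)
      - hA.1.eigenvalues i * Real.log (hB.1.eigenvalues j)
      - Real.log τ * hA.1.eigenvalues i - hA.1.eigenvalues i + τ * hB.1.eigenvalues j)
      * eigenOverlap hA.1 hB.1 i j := by
    refine Finset.sum_nonneg fun i _ => Finset.sum_nonneg fun j _ =>
      mul_nonneg ?_ (eigenOverlap_nonneg _ _ _ _)
    have ha := hA.eigenvalues_pos i
    have hb := hB.eigenvalues_pos j
    generalize hA.1.eigenvalues i = a at *
    generalize hB.1.eigenvalues j = b at *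
    have hl := Real.log_le_sub_one_of_pos (show 0 < τ * b / a by positivity)
    rw [Real.log_div (by positivity) ha.ne', Real.log_mul hτ.ne' hb.ne'] at hl
    have h2 := mul_le_mul_of_nonneg_left hl ha.le
    have h3 : a * (τ * b / a - 1) = τ * b - a := by field_simp
    nlinarith
  simp only [sub_mul, add_mul, Finset.sum_add_distrib, Finset.sum_sub_distrib, mul_assoc,
    ← Finset.mul_sum] at key e1 e2 e3 e4
  rw [← e1, ← e2, ← e3, ← e4] at key
  rw [matLog]
  linarith

/-- Second order accuracy of the first order expansion of `(p, B) ↦ tr |B| ^ p` at `(p₀, A)`. Since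
the traces are sums over pairs of eigenvalues with nonnegative weights, the scalar remainder
estimate passes to matrices, although `A` and `B` need not commute. -/
lemma exists_abs_trace_absPow_sub_le (hA : A.PosDef) (p₀ : ℝ) :
    ∃ C : ℝ, 0 ≤ C ∧ ∃ δ : ℝ, 0 < δ ∧ ∀ p ∈ Set.Icc (p₀ - 1) (p₀ + 1), ∀ B : Mat d,
      B.IsHermitian → ((B - A) * (B - A)).trace.re < δ → B.PosDef ∧
      |(absPow B p).trace.re - (absPow A p₀).trace.re
          - (p - p₀) * (cfc (fun x => x ^ p₀ * Real.log x) A).trace.re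
          - p₀ * (matPow A (p₀ - 1) * (B - A)).trace.re| ≤
        C * ((p - p₀) ^ 2 + ((B - A) * (B - A)).trace.re) := by
  obtain ⟨M, hM⟩ := (Set.finite_range hA.1.eigenvalues).bddAbove
  obtain ⟨K, hK⟩ := (Set.finite_range fun i => (hA.1.eigenvalues i)⁻¹).bddAbove
  set m : ℝ := (|K| + 1)⁻¹ with hmdef
  have hm : 0 < m := by positivity
  have hmle : ∀ i, m ≤ hA.1.eigenvalues i := fun i => by
    refine inv_le_of_inv_le₀ (hA.eigenvalues_pos i) ?_
    have := hK ⟨i, rfl⟩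
    simp only at this
    linarith [le_abs_self K]
  have hleM : ∀ i, hA.1.eigenvalues i ≤ M := fun i => hM ⟨i, rfl⟩
  obtain ⟨C, hC, h⟩ := exists_abs_rpow_sub_le p₀ (m / 2) (M + m / 2) (by positivity)
  refine ⟨C * (d + 1), by positivity, (m / 2) ^ 2, by positivity, fun p hp B hB hBA => ?_⟩
  have hBmem : ∀ j, hB.eigenvalues j ∈ Set.Icc (m / 2) (M + m / 2) := fun j => by
    obtain ⟨i, hi⟩ := exists_abs_eigenvalues_sub_lt hA.1 hB (by positivity) hBA j
    rw [abs_lt] at hi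
    constructor <;> linarith [hmle i, hleM i]
  have hBpos : ∀ j, 0 < hB.eigenvalues j := fun j => lt_of_lt_of_le (by positivity) (hBmem j).1
  refine ⟨hB.posDef_iff_eigenvalues_pos.2 hBpos, ?_⟩
  have e1 : (absPow B p).trace.re = ∑ i, ∑ j,
      hB.eigenvalues j ^ p * eigenOverlap hA.1 hB i j := by
    rw [absPow, trace_cfc_right_re hA.1 hB]
    simp only [abs_of_pos (hBpos _)]
  have e2 : (absPow A p₀).trace.re = ∑ i, ∑ j,
      hA.1.eigenvalues i ^ p₀ * eigenOverlap hA.1 hB i j := by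
    rw [absPow, trace_cfc_left_re hA.1 hB]
    simp only [abs_of_pos (hA.eigenvalues_pos _)]
  have e3 := trace_cfc_left_re hA.1 hB (fun x => x ^ p₀ * Real.log x)
  have e4 : (matPow A (p₀ - 1) * (B - A)).trace.re = ∑ i, ∑ j, hA.1.eigenvalues i ^ (p₀ - 1) *
      (hB.eigenvalues j - hA.1.eigenvalues i) * eigenOverlap hA.1 hB i j := by
    have h1 := trace_cfc_mul_cfc_re hA.1 hB (fun x => x ^ (p₀ - 1)) (fun x => x)
    have h2 := trace_cfc_left_re hA.1 hB (fun x => x ^ (p₀ - 1) * x)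
    rw [cfc_eq_self_of_isHermitian hB] at h1
    rw [← cfc_mul_cfc hA.1, cfc_eq_self_of_isHermitian hA.1] at h2
    rw [matPow, mul_sub, Matrix.trace_sub, Complex.sub_re, h1, h2]
    simp only [mul_sub, sub_mul, Finset.sum_sub_distrib]
  have e5 := trace_sub_sq_re hA.1 hB
  have e6 : ∑ i, ∑ j, (p - p₀) ^ 2 * eigenOverlap hA.1 hB i j = (p - p₀) ^ 2 * d := by
    rw [Finset.sum_comm]
    simp only [← Finset.mul_sum, sum_eigenOverlap_left]
    simp
  have hexp : (absPow B p).trace.re - (absPow A p₀).trace.re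
          - (p - p₀) * (cfc (fun x => x ^ p₀ * Real.log x) A).trace.re
          - p₀ * (matPow A (p₀ - 1) * (B - A)).trace.re =
      ∑ i, ∑ j, (hB.eigenvalues j ^ p - hA.1.eigenvalues i ^ p₀
        - (p - p₀) * (hA.1.eigenvalues i ^ p₀ * Real.log (hA.1.eigenvalues i))
        - p₀ * (hA.1.eigenvalues i ^ (p₀ - 1) * (hB.eigenvalues j - hA.1.eigenvalues i)))
        * eigenOverlap hA.1 hB i j := by
    rw [e1, e2, e3, e4]
    simp only [Finset.mul_sum, ← Finset.sum_sub_distrib]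
    exact Finset.sum_congr rfl fun i _ => Finset.sum_congr rfl fun j _ => by ring
  rw [hexp]
  have hnn := fun i j => eigenOverlap_nonneg hA.1 hB i j
  calc _ ≤ ∑ i, ∑ j, C * ((p - p₀) ^ 2 + (hB.eigenvalues j - hA.1.eigenvalues i) ^ 2)
        * eigenOverlap hA.1 hB i j := by
        refine (Finset.abs_sum_le_sum_abs _ _).trans (Finset.sum_le_sum fun i _ => ?_)
        refine (Finset.abs_sum_le_sum_abs _ _).trans (Finset.sum_le_sum fun j _ => ?_)
        rw [abs_mul, abs_of_nonneg (hnn i j)]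
        refine mul_le_mul_of_nonneg_right (h p hp _ ⟨?_, ?_⟩ _ (hBmem j)) (hnn i j)
        · linarith [hmle i]
        · linarith [hleM i]
    _ = C * ((p - p₀) ^ 2 * d + ((B - A) * (B - A)).trace.re) := by
        rw [← e6, e5, ← Finset.sum_add_distrib, Finset.mul_sum]
        refine Finset.sum_congr rfl fun i _ => ?_
        rw [← Finset.sum_add_distrib, Finset.mul_sum]
        exact Finset.sum_congr rfl fun j _ => by ring
    _ ≤ _ := by
        have h0 : 0 ≤ ((B - A) * (B - A)).trace.re := by
          rw [e5]
          exact Finset.sum_nonneg fun i _ => Finset.sum_nonneg fun j _ =>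
            mul_nonneg (sq_nonneg _) (hnn i j)
        have hd : (0 : ℝ) ≤ d := Nat.cast_nonneg d
        rw [mul_assoc]
        refine mul_le_mul_of_nonneg_left ?_ hC
        nlinarith [sq_nonneg (p - p₀), mul_nonneg hd h0]

end Klein

section TraceDeriv

open scoped Matrix.Norms.L2Operator

variable {d : ℕ}

lemma hasDerivAt_trace_mul_re {Y : ℝ → Mat d} {Y' : Mat d} {t : ℝ} (h : HasDerivAt Y Y' t)
    (M : Mat d) : HasDerivAt (fun s => (M * Y s).trace.re) (M * Y').trace.re t := by
  let φ : Mat d →ₗ[ℝ] ℝ :=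
    { toFun := fun Z => (M * Z).trace.re
      map_add' := fun a b => by simp [mul_add]
      map_smul' := fun c a => by simp [Matrix.trace_smul] }
  exact (LinearMap.toContinuousLinearMap φ).hasFDerivAt.comp_hasDerivAt t h

/-- The derivative of `t ↦ tr |X_t| ^ {p_t}` along a differentiable curve of Hermitian matrices,
at a point where the matrix is positive definite. -/
theorem hasDerivAt_trace_absPow {X : ℝ → Mat d} {X' : Mat d} {p : ℝ → ℝ} {p' t : ℝ}
    (hX : HasDerivAt X X' t) (hp : HasDerivAt p p' t) (hH : ∀ s, (X s).IsHermitian)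
    (hpos : (X t).PosDef) :
    HasDerivAt (fun s => (absPow (X s) (p s)).trace.re)
      (p' * (cfc (fun x => x ^ p t * Real.log x) (X t)).trace.re
        + p t * (matPow (X t) (p t - 1) * X').trace.re) t := by
  obtain ⟨C, hC, δ, hδ, h⟩ := exists_abs_trace_absPow_sub_le hpos (p t)
  set A := X t with hA
  have hq0 : (fun s => ((X s - A) * (X s - A)).trace.re) =O[nhds t] fun s => ‖s - t‖ ^ 2 := by
    let φ : Mat d →ₗ[ℝ] ℝ :=
      { toFun := fun Z => Z.trace.re
        map_add' := fun a b => by simp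
        map_smul' := fun c a => by simp [Matrix.trace_smul] }
    have h1 : (fun s => ((X s - A) * (X s - A)).trace.re) =O[nhds t]
        fun s => (X s - A) * (X s - A) :=
      (LinearMap.toContinuousLinearMap φ).isBigO_comp _ _
    have h2 : (fun s => X s - A) =O[nhds t] fun s => s - t := hX.isBigO_sub
    refine h1.trans ((h2.mul h2).trans (Asymptotics.isBigO_of_le _ fun s => ?_))
    simp [pow_two]
  have hp0 : (fun s => (p s - p t) ^ 2) =O[nhds t] fun s => ‖s - t‖ ^ 2 := by
    have h2 : (fun s => p s - p t) =O[nhds t] fun s => s - t := hp.isBigO_sub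
    refine (h2.pow 2).trans (Asymptotics.isBigO_of_le _ fun s => ?_)
    simp
  have hq_small : ∀ᶠ s in nhds t, ((X s - A) * (X s - A)).trace.re < δ := by
    have : Filter.Tendsto (fun s => ((X s - A) * (X s - A)).trace.re) (nhds t) (nhds 0) := by
      refine hq0.trans_tendsto ?_
      have : ContinuousAt (fun s : ℝ => ‖s - t‖ ^ 2) t := by fun_prop
      simpa [ContinuousAt] using this
    exact this.eventually_lt_const hδ
  have hp_small : ∀ᶠ s in nhds t, p s ∈ Set.Icc (p t - 1) (p t + 1) :=
    hp.continuousAt.eventually (Icc_mem_nhds (by linarith) (by linarith))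
  set R : ℝ → ℝ := fun s => (absPow (X s) (p s)).trace.re - (absPow A (p t)).trace.re
          - (p s - p t) * (cfc (fun x => x ^ p t * Real.log x) A).trace.re
          - p t * (matPow A (p t - 1) * (X s - A)).trace.re with hR
  have hRO : R =O[nhds t] fun s => ‖s - t‖ ^ 2 := by
    refine Asymptotics.IsBigO.trans (g := fun s =>
      (p s - p t) ^ 2 + ((X s - A) * (X s - A)).trace.re) ?_ (hp0.add hq0)
    refine Asymptotics.IsBigO.of_bound C ?_
    filter_upwards [hq_small, hp_small] with s hs1 hs2
    exact ((h (p s) hs2 (X s) (hH s) hs1).2).trans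
      (mul_le_mul_of_nonneg_left (le_abs_self _) hC)
  have hR' : HasDerivAt R 0 t := by
    have := (hRO.hasFDerivAt (𝕜 := ℝ) one_lt_two).hasDerivAt
    simpa using this
  have hlin1 := (hp.sub_const (p t)).mul_const
    (cfc (fun x => x ^ p t * Real.log x) A).trace.re
  have hlin2 := (hasDerivAt_trace_mul_re (hX.sub_const A) (matPow A (p t - 1))).const_mul (p t)
  have := ((hR'.add_const (absPow A (p t)).trace.re).add hlin1).add hlin2
  refine (this.congr_deriv (by ring)).congr_of_eventuallyEq
    (Filter.Eventually.of_forall fun s => ?_)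
  simp only [hR, Pi.add_apply]
  ring

end TraceDeriv

/-! ### Weighted norms, entropy and the Dirichlet form -/

section Powers

variable {d : ℕ} {A σ : Mat d}

lemma cfc_cfc (hA : A.IsHermitian) (f g : ℝ → ℝ) : cfc g (cfc f A) = cfc (fun x => g (f x)) A := by
  have hfin : (spectrum ℝ A).Finite := by
    rw [hA.spectrum_real_eq_range_eigenvalues]
    exact Set.finite_range _
  exact (cfc_comp' g f A ((hfin.image f).continuousOn g) (hfin.continuousOn f) hA).symm

lemma cfc_congr_of_posDef (hA : A.PosDef) {f g : ℝ → ℝ} (h : ∀ x, 0 < x → f x = g x) :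
    cfc f A = cfc g A :=
  cfc_congr_eigenvalues hA.1 fun i => h _ (hA.eigenvalues_pos i)

lemma absPow_eq_matPow (hA : A.PosDef) (s : ℝ) : absPow A s = matPow A s :=
  cfc_congr_of_posDef hA fun x hx => by rw [abs_of_pos hx]

lemma matPow_isHermitian (hA : A.PosDef) (s : ℝ) : (matPow A s).IsHermitian :=
  isHermitian_cfc hA.1 _

lemma matPow_mul_matPow (hA : A.PosDef) (s r : ℝ) :
    matPow A s * matPow A r = matPow A (s + r) := by
  rw [matPow, matPow, matPow, cfc_mul_cfc hA.1]
  exact cfc_congr_of_posDef hA fun x hx => (Real.rpow_add hx s r).symm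

lemma matPow_zero (hA : A.PosDef) : matPow A 0 = 1 := by
  simp only [matPow, Real.rpow_zero]
  exact cfc_one_of_isHermitian hA.1

lemma matPow_one (hA : A.PosDef) : matPow A 1 = A := by
  simp only [matPow, Real.rpow_one]
  exact cfc_eq_self_of_isHermitian hA.1

lemma matPow_posDef (hA : A.PosDef) (s : ℝ) : (matPow A s).PosDef := by
  have h : matPow A s = (matPow A (s / 2)).conjTranspose * matPow A (s / 2) := by
    rw [matPow_isHermitian hA, matPow_mul_matPow hA, add_halves]
  have hu : IsUnit (matPow A (s / 2)) := by
    refine IsUnit.of_mul_eq_one (matPow A (-(s / 2))) ?_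
    rw [matPow_mul_matPow hA, add_neg_cancel, matPow_zero hA]
  rw [h]
  exact Matrix.PosDef.conjTranspose_mul_self _ (Matrix.mulVec_injective_of_isUnit hu)

lemma matPow_matPow (hA : A.PosDef) (s r : ℝ) : matPow (matPow A s) r = matPow A (s * r) := by
  rw [matPow, matPow, matPow, cfc_cfc hA.1]
  exact cfc_congr_of_posDef hA fun x hx => (Real.rpow_mul hx.le s r).symm

lemma matPow_sub_one_mul (hA : A.PosDef) (p : ℝ) : matPow A (p - 1) * A = matPow A p := by
  have h := matPow_mul_matPow hA (p - 1) 1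
  rwa [matPow_one hA, sub_add_cancel] at h

lemma mul_matPow_sub_one (hA : A.PosDef) (p : ℝ) : A * matPow A (p - 1) = matPow A p := by
  have h := matPow_mul_matPow hA 1 (p - 1)
  rwa [matPow_one hA, add_sub_cancel] at h

lemma trace_matPow_sub_one_mul_anticomm (hA : A.PosDef) (p : ℝ) (M : Mat d) :
    (matPow A (p - 1) * (A * M + M * A)).trace.re = 2 * (matPow A p * M).trace.re := by
  rw [mul_add, Matrix.trace_add, Complex.add_re, ← mul_assoc, matPow_sub_one_mul hA, ← mul_assoc,
    Matrix.trace_mul_comm _ A, ← mul_assoc, mul_matPow_sub_one hA, two_mul]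

lemma matLog_mul_matPow_comm (hA : A.PosDef) (s : ℝ) :
    matLog A * matPow A s = matPow A s * matLog A := by
  rw [matPow, matLog, cfc_mul_cfc hA.1, cfc_mul_cfc hA.1]
  simp only [mul_comm]

lemma Gam_add_apply (σ : Mat d) (a : ℝ) (f g : Mat d) :
    Gam σ a (f + g) = Gam σ a f + Gam σ a g := by
  simp only [Gam, mul_add, add_mul]

lemma Gam_sub_apply (σ : Mat d) (a : ℝ) (f g : Mat d) :
    Gam σ a (f - g) = Gam σ a f - Gam σ a g := by
  simp only [Gam, mul_sub, sub_mul]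

lemma Gam_smul (σ : Mat d) (a c : ℝ) (f : Mat d) : Gam σ a (c • f) = c • Gam σ a f := by
  simp only [Gam, mul_smul_comm, smul_mul_assoc]

lemma Gam_Gam (hσ : σ.PosDef) (a b : ℝ) (f : Mat d) : Gam σ a (Gam σ b f) = Gam σ (a + b) f := by
  have h1 := matPow_mul_matPow hσ (a / 2) (b / 2)
  have h2 := matPow_mul_matPow hσ (b / 2) (a / 2)
  simp only [Gam]
  rw [show (a + b) / 2 = a / 2 + b / 2 by ring, ← h1]
  nth_rewrite 2 [h1]
  rw [add_comm (a / 2), ← h2]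
  simp only [mul_assoc]

lemma Gam_zero (hσ : σ.PosDef) (f : Mat d) : Gam σ 0 f = f := by
  simp [Gam, matPow_zero hσ]

lemma Gam_isHermitian (hσ : σ.PosDef) (a : ℝ) {f : Mat d} (hf : f.IsHermitian) :
    (Gam σ a f).IsHermitian := by
  have h := (matPow_isHermitian hσ (a / 2)).eq
  rw [Matrix.IsHermitian, Gam, Matrix.conjTranspose_mul, Matrix.conjTranspose_mul, h, hf.eq,
    mul_assoc]

lemma Gam_posDef (hσ : σ.PosDef) (a : ℝ) {f : Mat d} (hf : f.PosDef) : (Gam σ a f).PosDef := by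
  have hu : IsUnit (matPow σ (a / 2)) := (matPow_posDef hσ _).isUnit
  have := hf.conjTranspose_mul_mul_same (Matrix.mulVec_injective_of_isUnit hu)
  rwa [(matPow_isHermitian hσ (a / 2)).eq] at this

lemma trace_Gam_mul (σ : Mat d) (a : ℝ) (f g : Mat d) :
    (Gam σ a f * g).trace = (f * Gam σ a g).trace := by
  rw [Gam, Gam, mul_assoc, mul_assoc, Matrix.trace_mul_comm]
  simp only [mul_assoc]

/-- `Γ_σ^{1/p}` turns the duality pairing of `I_{q,p}(f)` into an unweighted trace pairing with
the power `p - 1`. -/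
lemma wInner_powOp_conj (hσ : σ.PosDef) {p : ℝ} (hp : 1 < p) {f : Mat d} (hf : f.PosDef)
    (g : Mat d) : wInner σ (powOp σ (p / (p - 1)) p f) g =
      (matPow (Gam σ (1 / p) f) (p - 1) * Gam σ (1 / p) g).trace.re := by
  have hp0 : p ≠ 0 := by linarith
  have hp1 : p - 1 ≠ 0 := by linarith
  rw [wInner, powOp, Gam_Gam hσ, absPow_eq_matPow (Gam_posDef hσ _ hf),
    show p / (p / (p - 1)) = p - 1 by field_simp,
    show 1 + -(1 / (p / (p - 1))) = 1 / p by field_simp; ring, trace_Gam_mul]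

/-- `tr |Γ_σ^{1/p}(f)| ^ p`, the `p`-th power of the weighted norm. -/
def weightedTrace (σ : Mat d) (p : ℝ) (f : Mat d) : ℝ :=
  (absPow (Gam σ (1 / p) f) p).trace.re

lemma weightedTrace_pos (hσ : σ.PosDef) (hσ1 : σ.trace = 1) (p : ℝ) {f : Mat d} (hf : f.PosDef) :
    0 < weightedTrace σ p f := by
  rcases isEmpty_or_nonempty (Fin d) with he | hne
  · simp [Matrix.trace] at hσ1
  rw [weightedTrace, absPow_eq_matPow (Gam_posDef hσ _ hf)]
  exact (Complex.lt_def.1 (matPow_posDef (Gam_posDef hσ _ hf) p).trace_pos).1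

/-- The relative entropy in terms of `X = Γ_σ^{1/p}(f)`. -/
lemma relEnt_eq (hσ : σ.PosDef) (hσ1 : σ.trace = 1) {p : ℝ} (hp : 1 < p) {f : Mat d}
    (hf : f.PosDef) : relEnt σ p f =
      (cfc (fun x => x ^ p * Real.log x) (Gam σ (1 / p) f)).trace.re
        - 1 / p * (matPow (Gam σ (1 / p) f) p * matLog σ).trace.re
        - 1 / p * (weightedTrace σ p f * Real.log (weightedTrace σ p f)) := by
  have hp0 : p ≠ 0 := by linarith
  have hF := weightedTrace_pos hσ hσ1 p hf
  have hX := Gam_posDef hσ (1 / p) hf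
  have hS : Gam σ (1 / p) (opEntropy σ p f) =
      Gam σ (1 / p) f * matLog (Gam σ (1 / p) f)
        - (1 / (2 * p)) • (Gam σ (1 / p) f * matLog σ + matLog σ * Gam σ (1 / p) f) := by
    rw [opEntropy, Gam_sub_apply, Gam_Gam hσ, add_neg_cancel, Gam_zero hσ, Gam_smul,
      Gam_add_apply]
    have h := matLog_mul_matPow_comm hσ (1 / p / 2)
    congr 3
    · simp only [Gam, mul_assoc, h]
    · simp only [Gam, ← mul_assoc, h]
  have hN : lpNorm σ p f = weightedTrace σ p f ^ (1 / p) := rfl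
  rw [relEnt, wInner_powOp_conj hσ hp hf, hS, hN, ← Real.rpow_mul hF.le, one_div_mul_cancel hp0,
    Real.rpow_one, Real.log_rpow hF]
  generalize Gam σ (1 / p) f = X at *
  have t1 : (matPow X (p - 1) * (X * matLog X)) = cfc (fun x => x ^ p * Real.log x) X := by
    rw [← mul_assoc, matPow_sub_one_mul hX, matPow, matLog, cfc_mul_cfc hX.1]
  rw [mul_sub, mul_smul_comm, Matrix.trace_sub, Matrix.trace_smul, t1,
    Complex.sub_re, Complex.smul_re, trace_matPow_sub_one_mul_anticomm hX, smul_eq_mul]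
  field_simp

lemma dirichlet_eq (L : Mat d →ₗ[ℂ] Mat d) (hσ : σ.PosDef) {p : ℝ} (hp : 1 < p) {f : Mat d}
    (hf : f.PosDef) : dirichlet L σ p f =
      -p / (2 * (p - 1)) *
        (matPow (Gam σ (1 / p) f) (p - 1) * Gam σ (1 / p) (L f)).trace.re := by
  rw [dirichlet, if_neg (by linarith), wInner_powOp_conj hσ hp hf]

/-- The relative entropy is nonnegative: it is the quantum relative entropy of
`Γ_σ^{1/p}(f) ^ p` and `σ`, up to normalization. -/
lemma relEnt_nonneg (hσ : σ.PosDef) (hσ1 : σ.trace = 1) {p : ℝ} (hp : 1 < p) {f : Mat d}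
    (hf : f.PosDef) : 0 ≤ relEnt σ p f := by
  have hp0 : 0 < p := by linarith
  have hX := Gam_posDef hσ (1 / p) hf
  have hF : weightedTrace σ p f = (matPow (Gam σ (1 / p) f) p).trace.re := by
    rw [weightedTrace, absPow_eq_matPow hX]
  rw [relEnt_eq hσ hσ1 hp hf, hF]
  generalize Gam σ (1 / p) f = X at *
  have hK := trace_mul_log_trace_le (matPow_posDef hX p) hσ hσ1
  have h1 : cfc (fun x => x * Real.log x) (matPow X p) =
      p • cfc (fun x => x ^ p * Real.log x) X := by
    rw [matPow, cfc_cfc hX.1, smul_cfc hX.1]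
    exact cfc_congr_of_posDef hX fun x hx => by rw [Real.log_rpow hx]; ring
  rw [h1, Matrix.trace_smul, Complex.smul_re, smul_eq_mul] at hK
  have h2 : 0 ≤ 1 / p * (p * (cfc (fun x => x ^ p * Real.log x) X).trace.re
      - (matPow X p * matLog σ).trace.re
      - (matPow X p).trace.re * Real.log (matPow X p).trace.re) :=
    mul_nonneg (by positivity) (by linarith)
  refine h2.trans_eq ?_
  field_simp

lemma powOp_posDef (hσ : σ.PosDef) (p q : ℝ) {f : Mat d} (hf : f.PosDef) :
    (powOp σ p q f).PosDef := by
  rw [powOp, absPow_eq_matPow (Gam_posDef hσ _ hf)]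
  exact Gam_posDef hσ _ (matPow_posDef (Gam_posDef hσ _ hf) _)

/-- Both entropies are built from the same matrix, since `Γ_σ^{1/2}(I_{2,p}(f))` is
`Γ_σ^{1/p}(f) ^ (p / 2)`. -/
lemma relEnt_two_powOp (hσ : σ.PosDef) (hσ1 : σ.trace = 1) {p : ℝ} (hp : 1 < p) {f : Mat d}
    (hf : f.PosDef) : relEnt σ 2 (powOp σ 2 p f) = p / 2 * relEnt σ p f := by
  have hX := Gam_posDef hσ (1 / p) hf
  have hg := powOp_posDef hσ 2 p hf
  have hG : Gam σ (1 / 2) (powOp σ 2 p f) = matPow (Gam σ (1 / p) f) (p / 2) := by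
    rw [powOp, Gam_Gam hσ, add_neg_cancel, Gam_zero hσ, absPow_eq_matPow hX]
  have hW : weightedTrace σ 2 (powOp σ 2 p f) = weightedTrace σ p f := by
    rw [weightedTrace, weightedTrace, hG, absPow_eq_matPow (matPow_posDef hX _),
      absPow_eq_matPow hX, matPow_matPow hX, div_mul_cancel₀ p two_ne_zero]
  rw [relEnt_eq hσ hσ1 one_lt_two hg, relEnt_eq hσ hσ1 hp hf, hW, hG]
  have h1 : cfc (fun x => x ^ (2 : ℝ) * Real.log x) (matPow (Gam σ (1 / p) f) (p / 2)) =
      (p / 2) • cfc (fun x => x ^ p * Real.log x) (Gam σ (1 / p) f) := by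
    rw [matPow, cfc_cfc hX.1, smul_cfc hX.1]
    refine cfc_congr_of_posDef hX fun x hx => ?_
    rw [Real.log_rpow hx, ← Real.rpow_mul hx.le, div_mul_cancel₀ p two_ne_zero]
    ring
  rw [h1, matPow_matPow hX, div_mul_cancel₀ p two_ne_zero, Matrix.trace_smul, Complex.smul_re,
    smul_eq_mul]
  field_simp

end Powers

section Derivative

open scoped Matrix.Norms.L2Operator

variable {d : ℕ} {σ : Mat d}

lemma hasDerivAt_matPow (hσ : σ.PosDef) {r : ℝ → ℝ} {r' t : ℝ} (hr : HasDerivAt r r' t) :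
    HasDerivAt (fun s => matPow σ (r s)) (r' • (matLog σ * matPow σ (r t))) t := by
  have h : HasDerivAt (fun s => ∑ i, (hσ.1.eigenvalues i ^ r s) • eigenProj hσ.1 i)
      (∑ i, (Real.log (hσ.1.eigenvalues i) * r' * hσ.1.eigenvalues i ^ r t) •
        eigenProj hσ.1 i) t :=
    HasDerivAt.fun_sum fun i _ =>
      (hr.const_rpow (hσ.eigenvalues_pos i)).smul_const (eigenProj hσ.1 i)
  have e : r' • (matLog σ * matPow σ (r t)) =
      ∑ i, (Real.log (hσ.1.eigenvalues i) * r' * hσ.1.eigenvalues i ^ r t) •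
        eigenProj hσ.1 i := by
    rw [matLog, matPow, cfc_mul_cfc hσ.1, smul_cfc hσ.1, cfc_eq_sum_eigenProj hσ.1]
    exact Finset.sum_congr rfl fun i _ => by congr 1; ring
  rw [e]
  simpa only [matPow, cfc_eq_sum_eigenProj hσ.1] using h

lemma hasDerivAt_Gam (hσ : σ.PosDef) {r : ℝ → ℝ} {r' t : ℝ} (hr : HasDerivAt r r' t)
    {f : ℝ → Mat d} {f' : Mat d} (hf : HasDerivAt f f' t) :
    HasDerivAt (fun s => Gam σ (r s) (f s)) (Gam σ (r t) f' +
      (r' / 2) • (matLog σ * Gam σ (r t) (f t) + Gam σ (r t) (f t) * matLog σ)) t := by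
  have h1 := hasDerivAt_matPow hσ (hr.div_const 2)
  refine ((h1.fun_mul hf).fun_mul h1).congr_deriv ?_
  simp only [Gam, matLog_mul_matPow_comm hσ, add_mul, smul_mul_assoc, mul_smul_comm, smul_add]
  rw [← matLog_mul_matPow_comm hσ]
  simp only [mul_assoc]
  rw [matLog_mul_matPow_comm hσ]
  abel

/-- The derivative of `tr |Γ_σ^{1/p}(f)| ^ p` along a path of `f` and `p`. -/
lemma hasDerivAt_weightedTrace (hσ : σ.PosDef) (hσ1 : σ.trace = 1) {p : ℝ → ℝ} {p' t : ℝ}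
    (hp : HasDerivAt p p' t) (hp1 : 1 < p t) {f : ℝ → Mat d} {f' : Mat d}
    (hf : HasDerivAt f f' t) (hH : ∀ s, (f s).IsHermitian) (hpos : (f t).PosDef) :
    HasDerivAt (fun s => weightedTrace σ (p s) (f s))
      (p' * (relEnt σ (p t) (f t)
          + 1 / p t * (weightedTrace σ (p t) (f t) * Real.log (weightedTrace σ (p t) (f t))))
        + p t * (matPow (Gam σ (1 / p t) (f t)) (p t - 1) * Gam σ (1 / p t) f').trace.re) t := by
  have hp0 : p t ≠ 0 := by linarith
  have hr : HasDerivAt (fun s => 1 / p s) (-p' / p t ^ 2) t := by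
    simpa only [one_div] using hp.fun_inv hp0
  have hX := hasDerivAt_Gam hσ hr hf
  have hXp := Gam_posDef hσ (1 / p t) hpos
  refine (hasDerivAt_trace_absPow hX hp (fun s => Gam_isHermitian hσ _ (hH s)) hXp).congr_deriv ?_
  rw [relEnt_eq hσ hσ1 hp1 hpos]
  generalize weightedTrace σ (p t) (f t) = W
  generalize Gam σ (1 / p t) (f t) = X at *
  generalize Gam σ (1 / p t) f' = Y
  rw [mul_add, mul_smul_comm, add_comm (matLog σ * X), Matrix.trace_add, Matrix.trace_smul,
    Complex.add_re, Complex.smul_re, trace_matPow_sub_one_mul_anticomm hXp, smul_eq_mul]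
  field_simp
  ring

end Derivative

/-! ### Positivity of the semigroup -/

section QuadraticForm

open scoped Matrix

variable {d : ℕ} {A : Mat d}

lemma dotProduct_mulVec_eq_ofReal (hA : A.IsHermitian) (v : Fin d → ℂ) :
    star v ⬝ᵥ A *ᵥ v = ((star v ⬝ᵥ A *ᵥ v).re : ℂ) := by
  refine Complex.ext rfl ?_
  simpa using hA.im_star_dotProduct_mulVec_self v

lemma dotProduct_mulVec_re_eq_norm_sq_mul (A : Mat d) {v : Fin d → ℂ} (hv : v ≠ 0) :
    (star v ⬝ᵥ A *ᵥ v).re = ‖v‖ ^ 2 *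
      (star ((‖v‖⁻¹ : ℂ) • v) ⬝ᵥ A *ᵥ ((‖v‖⁻¹ : ℂ) • v)).re := by
  have hn : ‖v‖ ≠ 0 := norm_ne_zero_iff.2 hv
  have h : star ((‖v‖⁻¹ : ℂ) • v) ⬝ᵥ A *ᵥ ((‖v‖⁻¹ : ℂ) • v) =
      ((‖v‖⁻¹ ^ 2 : ℝ) : ℂ) * (star v ⬝ᵥ A *ᵥ v) := by
    rw [star_smul, Matrix.mulVec_smul, smul_dotProduct, dotProduct_smul]
    simp
    ring
  rw [h, Complex.re_ofReal_mul, ← mul_assoc, ← mul_pow, mul_inv_cancel₀ hn, one_pow, one_mul]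

lemma norm_inv_norm_smul {v : Fin d → ℂ} (hv : v ≠ 0) : ‖(‖v‖⁻¹ : ℂ) • v‖ = 1 := by
  have hn : ‖v‖ ≠ 0 := norm_ne_zero_iff.2 hv
  rw [norm_smul]
  simp [hn]

/-- Positivity may be tested on the unit sphere; it is the sphere of the sup norm on `Fin d → ℂ`, of
which only compactness and homogeneity matter. -/
lemma posDef_of_forall_sphere (hA : A.IsHermitian)
    (h : ∀ v : Fin d → ℂ, ‖v‖ = 1 → 0 < (star v ⬝ᵥ A *ᵥ v).re) : A.PosDef := by
  refine Matrix.PosDef.of_dotProduct_mulVec_pos hA fun v hv => ?_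
  rw [dotProduct_mulVec_eq_ofReal hA, Complex.zero_lt_real,
    dotProduct_mulVec_re_eq_norm_sq_mul A hv]
  exact mul_pos (pow_pos (norm_pos_iff.2 hv) 2) (h _ (norm_inv_norm_smul hv))

lemma posSemidef_of_forall_sphere (hA : A.IsHermitian)
    (h : ∀ v : Fin d → ℂ, ‖v‖ = 1 → 0 ≤ (star v ⬝ᵥ A *ᵥ v).re) : A.PosSemidef := by
  refine Matrix.PosSemidef.of_dotProduct_mulVec_nonneg hA fun v => ?_
  rcases eq_or_ne v 0 with rfl | hv
  · simp
  rw [dotProduct_mulVec_eq_ofReal hA, Complex.zero_le_real,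
    dotProduct_mulVec_re_eq_norm_sq_mul A hv]
  exact mul_nonneg (sq_nonneg _) (h _ (norm_inv_norm_smul hv))

lemma exists_pos_sub_smul_one_posDef (hA : A.PosDef) :
    ∃ c : ℝ, 0 < c ∧ (A - c • (1 : Mat d)).PosDef := by
  obtain ⟨_, _, δ, hδ, h⟩ := exists_abs_trace_absPow_sub_le hA 1
  have hc : 0 < Real.sqrt (δ / (d + 1)) := by positivity
  refine ⟨Real.sqrt (δ / (d + 1)), hc, (h 1 (by constructor <;> norm_num) _ ?_ ?_).1⟩
  · exact hA.1.sub (Matrix.isHermitian_one.smul (by simp [IsSelfAdjoint]))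
  · rw [sub_sub_cancel_left, neg_mul_neg, smul_mul_smul_comm, mul_one, Matrix.trace_smul,
      Matrix.trace_one, Real.mul_self_sqrt (by positivity)]
    simp only [Fintype.card_fin, Complex.smul_re, Complex.natCast_re, smul_eq_mul]
    rw [div_mul_eq_mul_div, div_lt_iff₀ (by positivity)]
    linarith

end QuadraticForm

section Liouvillian

open scoped Matrix

variable {d : ℕ} {L : Mat d →ₗ[ℂ] Mat d}

lemma IsLiouvillian.map_one (hL : IsLiouvillian L) : L 1 = 0 := by
  obtain ⟨H, m, K, -, h⟩ := hL
  rw [h]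
  simp only [mul_one, one_mul, sub_self, smul_zero, zero_add]
  refine Finset.sum_eq_zero fun i _ => ?_
  rw [← two_smul ℂ, smul_smul]
  norm_num

lemma IsLiouvillian.isHermitian (hL : IsLiouvillian L) {f : Mat d} (hf : f.IsHermitian) :
    (L f).IsHermitian := by
  obtain ⟨H, m, K, hH, h⟩ := hL
  rw [h, Matrix.IsHermitian]
  simp only [Matrix.conjTranspose_add, Matrix.conjTranspose_smul, Matrix.conjTranspose_sub,
    Matrix.conjTranspose_mul, Matrix.conjTranspose_sum, Matrix.conjTranspose_conjTranspose,
    hf.eq, hH.eq]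
  congr 1
  · rw [← neg_sub, smul_neg, ← neg_smul]
    simp
  · refine Finset.sum_congr rfl fun i _ => ?_
    congr 1
    · simp only [mul_assoc]
    · rw [add_comm]
      simp only [mul_assoc]
      congr 1
      simp

/-- The generator of a positive semigroup: a positive semidefinite `g` cannot be pushed out of the
cone at a vector in its kernel. -/
lemma IsLiouvillian.dotProduct_mulVec_nonneg_of_mulVec_eq_zero (hL : IsLiouvillian L) {g : Mat d}
    (hg : g.PosSemidef) {v : Fin d → ℂ} (hv : g *ᵥ v = 0) : 0 ≤ star v ⬝ᵥ L g *ᵥ v := by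
  obtain ⟨H, m, K, hH, h⟩ := hL
  have hv' : star v ᵥ* g = 0 := by
    have := congrArg star hv
    rwa [Matrix.star_mulVec, hg.1.eq, star_zero] at this
  have e1 : ∀ M : Mat d, star v ⬝ᵥ (M * g) *ᵥ v = 0 := fun M => by
    rw [← Matrix.mulVec_mulVec, hv, Matrix.mulVec_zero, dotProduct_zero]
  have e2 : ∀ M : Mat d, star v ⬝ᵥ (g * M) *ᵥ v = 0 := fun M => by
    rw [← Matrix.mulVec_mulVec, Matrix.dotProduct_mulVec, hv', zero_dotProduct]
  rw [h, Matrix.add_mulVec, dotProduct_add, Matrix.smul_mulVec, Matrix.sub_mulVec,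
    dotProduct_smul, dotProduct_sub, e1, e2, sub_self, smul_zero, zero_add, Matrix.sum_mulVec,
    dotProduct_sum]
  refine Finset.sum_nonneg fun i _ => ?_
  rw [Matrix.sub_mulVec, dotProduct_sub, Matrix.smul_mulVec, dotProduct_smul, Matrix.add_mulVec,
    dotProduct_add, e1, e2, add_zero, smul_zero, sub_zero]
  exact (hg.conjTranspose_mul_mul_same (K i)).dotProduct_mulVec_nonneg v

end Liouvillian

section Exponential

variable {E : Type*} [NormedAddCommGroup E] [NormedSpace ℂ E] [CompleteSpace E]

lemma hasDerivAt_exp_ofReal_smul_apply (A : E →L[ℂ] E) (x : E) (t : ℝ) :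
    HasDerivAt (fun s : ℝ => NormedSpace.exp ((s : ℂ) • A) x)
      (A (NormedSpace.exp ((t : ℂ) • A) x)) t := by
  have h : HasDerivAt (fun z : ℂ => NormedSpace.exp (z • A) x)
      (A (NormedSpace.exp ((t : ℂ) • A) x)) (t : ℂ) :=
    (ContinuousLinearMap.apply ℂ E x).hasFDerivAt.comp_hasDerivAt (t : ℂ)
      (hasDerivAt_exp_smul_const' A (t : ℂ))
  have h2 := h.scomp t Complex.ofRealCLM.hasDerivAt
  rw [Complex.ofRealCLM_apply, Complex.ofReal_one, one_smul] at h2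
  exact h2

lemma hasSum_exp_ofReal_smul_apply (A : E →L[ℂ] E) (x : E) (t : ℝ) :
    HasSum (fun n : ℕ => ((n.factorial : ℝ)⁻¹ * t ^ n) • (A ^ n) x)
      (NormedSpace.exp ((t : ℂ) • A) x) := by
  have h := (ContinuousLinearMap.apply ℂ E x).hasSum
    (NormedSpace.exp_series_hasSum_exp' (𝕂 := ℂ) ((t : ℂ) • A))
  convert! h using 2 with n
  rw [smul_pow, smul_smul, map_smul, ContinuousLinearMap.apply_apply, ← Complex.coe_smul]
  simp

lemma exp_ofReal_smul_apply_of_apply_eq_zero {A : E →L[ℂ] E} {x : E} (hx : A x = 0) (t : ℝ) :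
    NormedSpace.exp ((t : ℂ) • A) x = x := by
  refine (hasSum_exp_ofReal_smul_apply A x t).unique ?_
  convert! hasSum_single (f := fun n : ℕ => ((n.factorial : ℝ)⁻¹ * t ^ n) • (A ^ n) x) 0
    fun n hn => ?_
  · simp
  · obtain ⟨k, rfl⟩ := Nat.exists_eq_succ_of_ne_zero hn
    change _ • (A ^ (k + 1)) x = 0
    rw [show (A ^ (k + 1)) x = (A ^ k) (A x) by rw [pow_succ]; rfl, hx, map_zero, smul_zero]

end Exponential

section Semigroup

open scoped Matrix.Norms.L2Operator Matrix

variable {d : ℕ} {L : Mat d →ₗ[ℂ] Mat d}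

lemma semigroup_zero (L : Mat d →ₗ[ℂ] Mat d) (f : Mat d) : semigroup L 0 f = f := by
  have h : (((0 : ℝ) : ℂ) • LinearMap.toContinuousLinearMap L) = 0 := by
    ext1 g
    change ((0 : ℝ) : ℂ) • L g = 0
    rw [Complex.ofReal_zero, zero_smul]
  rw [semigroup, h, NormedSpace.exp_zero]
  rfl

lemma hasDerivAt_semigroup (L : Mat d →ₗ[ℂ] Mat d) (f : Mat d) (t : ℝ) :
    HasDerivAt (fun s => semigroup L s f) (L (semigroup L t f)) t :=
  hasDerivAt_exp_ofReal_smul_apply (LinearMap.toContinuousLinearMap L) f t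

lemma semigroup_isHermitian (hL : IsLiouvillian L) {f : Mat d} (hf : f.IsHermitian) (t : ℝ) :
    (semigroup L t f).IsHermitian := by
  have h : HasSum (fun n : ℕ => ((n.factorial : ℝ)⁻¹ * t ^ n) •
      ((LinearMap.toContinuousLinearMap L) ^ n) f) (semigroup L t f) :=
    hasSum_exp_ofReal_smul_apply (LinearMap.toContinuousLinearMap L) f t
  have h2 : ∀ n : ℕ, star (((LinearMap.toContinuousLinearMap L) ^ n) f) =
      ((LinearMap.toContinuousLinearMap L) ^ n) f := by
    intro n
    induction n with
    | zero => exact hf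
    | succ n ih =>
      rw [pow_succ']
      exact hL.isHermitian ih
  refine h.star.unique ?_
  simpa only [star_smul, h2, star_trivial] using h

/-- The semigroup maps positive definite matrices to positive definite matrices, up to an
arbitrarily slow drift. The drift makes the quadratic form strictly increasing at the first time
and vector where it could vanish. -/
lemma semigroup_add_smul_posDef (hL : IsLiouvillian L) {f : Mat d} (hf : f.PosDef) {ε : ℝ}
    (hε : 0 < ε) {T : ℝ} (hT : 0 ≤ T) : (semigroup L T f + (ε * T) • (1 : Mat d)).PosDef := by
  set g : ℝ → Mat d := fun s => semigroup L s f + (ε * s) • (1 : Mat d) with hg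
  have hgH : ∀ s, (g s).IsHermitian := fun s =>
    (semigroup_isHermitian hL hf.1 s).add (Matrix.isHermitian_one.smul (by simp [IsSelfAdjoint]))
  have hgd : ∀ s, HasDerivAt g (L (g s) + ε • (1 : Mat d)) s := fun s => by
    have h1 := (hasDerivAt_semigroup L f s).add
      (((hasDerivAt_id s).const_mul ε).smul_const (1 : Mat d))
    refine h1.congr_deriv ?_
    have h2 : L ((ε * s) • (1 : Mat d)) = 0 := by
      rw [← Complex.coe_smul, map_smul, hL.map_one, smul_zero]
    simp only [hg, map_add, h2, add_zero, mul_one]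
  have hgc : Continuous g := continuous_iff_continuousAt.2 fun s => (hgd s).continuousAt
  let φ : ℝ × (Fin d → ℂ) → ℝ := fun z => (star z.2 ⬝ᵥ g z.1 *ᵥ z.2).re
  have hφ : Continuous φ := by
    have h1 : Continuous fun z : ℝ × (Fin d → ℂ) => g z.1 := hgc.comp continuous_fst
    exact Complex.continuous_re.comp
      (continuous_snd.star.dotProduct (h1.matrix_mulVec continuous_snd))
  by_contra hcon
  have hex : ∃ v : Fin d → ℂ, ‖v‖ = 1 ∧ φ (T, v) ≤ 0 := by
    by_contra! h
    exact hcon (posDef_of_forall_sphere (hgH T) h)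
  obtain ⟨v₁, hv₁, hφ₁⟩ := hex
  have hK : IsCompact ((Set.Icc 0 T ×ˢ Metric.sphere (0 : Fin d → ℂ) 1) ∩ {z | φ z ≤ 0}) :=
    (isCompact_Icc.prod (isCompact_sphere _ _)).inter_right (isClosed_le hφ continuous_const)
  obtain ⟨⟨s, v⟩, ⟨⟨hs, hv⟩, hsv⟩, hmin⟩ := hK.exists_isMinOn
    ⟨(T, v₁), ⟨⟨hT, le_rfl⟩, by simpa using hv₁⟩, hφ₁⟩ continuous_fst.continuousOn
  simp only [mem_sphere_zero_iff_norm, Set.mem_ofPred_eq] at hs hv hsv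
  have hv0 : v ≠ 0 := by
    rintro rfl
    simp at hv
  -- before the first vanishing time the form is positive
  have hbefore : ∀ r, 0 ≤ r → r < s → ∀ w : Fin d → ℂ, ‖w‖ = 1 → 0 < φ (r, w) := by
    intro r hr hrs w hw
    by_contra! hle
    have := hmin (a := (r, w)) ⟨⟨⟨hr, hrs.le.trans hs.2⟩, by simpa using hw⟩, hle⟩
    exact absurd hrs (not_lt.2 this)
  have hs0 : 0 < s := by
    refine lt_of_le_of_ne hs.1 fun h => ?_
    subst h
    have h0 : g 0 = f := by simp [hg, semigroup_zero]
    have h1 := hf.re_dotProduct_pos hv0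
    simp only [φ, h0] at hsv
    exact absurd h1 (not_lt.2 hsv)
  have hleft : ∀ᶠ r in nhdsWithin s (Set.Iio s), 0 ≤ r ∧ r < s := by
    filter_upwards [Ioo_mem_nhdsLT hs0] with r hr using ⟨hr.1.le, hr.2⟩
  have hpsd : (g s).PosSemidef := by
    refine posSemidef_of_forall_sphere (hgH s) fun w hw => ?_
    have hc : Filter.Tendsto (fun r => φ (r, w)) (nhdsWithin s (Set.Iio s)) (nhds (φ (s, w))) :=
      ((hφ.comp (Continuous.prodMk_left w)).tendsto s).mono_left nhdsWithin_le_nhds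
    refine ge_of_tendsto hc ?_
    filter_upwards [hleft] with r hr using (hbefore r hr.1 hr.2 w hw).le
  have hz : φ (s, v) = 0 := le_antisymm hsv (hpsd.re_dotProduct_nonneg v)
  have hker : g s *ᵥ v = 0 := by
    rw [← hpsd.dotProduct_mulVec_zero_iff, dotProduct_mulVec_eq_ofReal (hgH s)]
    exact congrArg _ hz
  have hder : HasDerivAt (fun r => φ (r, v)) (star v ⬝ᵥ (L (g s) + ε • (1 : Mat d)) *ᵥ v).re s := by
    let ψ : Mat d →ₗ[ℝ] ℝ :=
      { toFun := fun Z => (star v ⬝ᵥ Z *ᵥ v).re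
        map_add' := fun a b => by simp [Matrix.add_mulVec]
        map_smul' := fun c a => by simp [Matrix.smul_mulVec] }
    exact (LinearMap.toContinuousLinearMap ψ).hasFDerivAt.comp_hasDerivAt s (hgd s)
  have hpos : 0 < (star v ⬝ᵥ (L (g s) + ε • (1 : Mat d)) *ᵥ v).re := by
    have h1 := (Complex.le_def.1 (hL.dotProduct_mulVec_nonneg_of_mulVec_eq_zero hpsd hker)).1
    have h2 : 0 < (star v ⬝ᵥ v).re := by
      have := (Matrix.PosDef.one (n := Fin d) (R := ℂ)).re_dotProduct_pos hv0
      simpa using this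
    rw [Matrix.add_mulVec, dotProduct_add, Matrix.smul_mulVec, Matrix.one_mulVec, dotProduct_smul,
      Complex.add_re, Complex.smul_re, smul_eq_mul]
    rw [Complex.zero_re] at h1
    have := mul_pos hε h2
    linarith
  have hslope := hder.hasDerivWithinAt (s := Set.Iio s)
  rw [hasDerivWithinAt_iff_tendsto_slope' (by simp)] at hslope
  refine absurd (le_of_tendsto hslope (b := 0) ?_) (not_le.2 hpos)
  filter_upwards [hleft] with r hr
  rw [slope_def_field, hz, sub_zero]
  exact div_nonpos_of_nonneg_of_nonpos (hbefore r hr.1 hr.2 v hv).le (by linarith [hr.2])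

/-- The semigroup of a Liouvillian maps positive definite matrices to positive definite
matrices. -/
theorem semigroup_posDef (hL : IsLiouvillian L) {f : Mat d} (hf : f.PosDef) {T : ℝ}
    (hT : 0 ≤ T) : (semigroup L T f).PosDef := by
  rcases hT.eq_or_lt with rfl | hT0
  · rwa [semigroup_zero]
  -- a small multiple `c` of the identity, which the semigroup fixes, absorbs the drift
  obtain ⟨c, hc, hfc⟩ := exists_pos_sub_smul_one_posDef hf
  have h := semigroup_add_smul_posDef hL hfc (div_pos hc hT0) hT
  have h1 : semigroup L T (c • (1 : Mat d)) = c • (1 : Mat d) := by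
    refine exp_ofReal_smul_apply_of_apply_eq_zero (A := LinearMap.toContinuousLinearMap L) ?_ T
    change L (c • (1 : Mat d)) = 0
    rw [← Complex.coe_smul, map_smul, hL.map_one, smul_zero]
  rw [map_sub, h1, div_mul_cancel₀ c hT0.ne', sub_add_cancel] at h
  exact h

end Semigroup

/-! ### Logarithmic Sobolev inequalities and hypercontractivity -/

section LogNorm

variable {d : ℕ} {L : Mat d →ₗ[ℂ] Mat d} {σ : Mat d}

lemma lpNorm_pos (hσ : σ.PosDef) (hσ1 : σ.trace = 1) (p : ℝ) {f : Mat d} (hf : f.PosDef) :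
    0 < lpNorm σ p f :=
  Real.rpow_pos_of_pos (weightedTrace_pos hσ hσ1 p hf) _

/-- The derivative of the logarithm of the norm along the semigroup, for the exponents
`p(s) = 1 + exp (c s)`: its sign is that of `c Ent_p - 2 E_p`. -/
theorem hasDerivAt_log_lpNorm_semigroup (hL : IsLiouvillian L) (hσ : σ.PosDef)
    (hσ1 : σ.trace = 1) {f : Mat d} (hf : f.PosDef) (c : ℝ) {t : ℝ} (ht : 0 ≤ t) :
    HasDerivAt (fun s => Real.log (lpNorm σ (1 + Real.exp (c * s)) (semigroup L s f)))
      (Real.exp (c * t) * (c * relEnt σ (1 + Real.exp (c * t)) (semigroup L t f)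
          - 2 * dirichlet L σ (1 + Real.exp (c * t)) (semigroup L t f)) /
        ((1 + Real.exp (c * t)) *
          weightedTrace σ (1 + Real.exp (c * t)) (semigroup L t f))) t := by
  have hft := semigroup_posDef hL hf ht
  have hp : HasDerivAt (fun s => 1 + Real.exp (c * s)) (Real.exp (c * t) * c) t := by
    simpa using (((hasDerivAt_id t).const_mul c).exp).const_add 1
  have hp1 : 1 < 1 + Real.exp (c * t) := by linarith [Real.exp_pos (c * t)]
  have hW := weightedTrace_pos hσ hσ1 (1 + Real.exp (c * t)) hft
  have hWd := hasDerivAt_weightedTrace hσ hσ1 hp hp1 (hasDerivAt_semigroup L f t)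
    (semigroup_isHermitian hL hf.1) hft
  have hE := dirichlet_eq L hσ hp1 hft
  have hp0 : (1 + Real.exp (c * t)) ≠ 0 := by positivity
  have hG := (hWd.log hW.ne').fun_div hp hp0
  have heq : (fun s => Real.log (lpNorm σ (1 + Real.exp (c * s)) (semigroup L s f)))
      =ᶠ[nhds t] fun s => Real.log (weightedTrace σ (1 + Real.exp (c * s)) (semigroup L s f)) /
        (1 + Real.exp (c * s)) := by
    filter_upwards [hWd.continuousAt.eventually_const_lt hW] with s hs
    change Real.log (weightedTrace σ _ _ ^ _) = _
    rw [Real.log_rpow hs]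
    ring
  refine (hG.congr_of_eventuallyEq heq).congr_deriv ?_
  rw [hE]
  have hx := Real.exp_pos (c * t)
  simp only [add_sub_cancel_left]
  generalize (matPow (Gam σ (1 / (1 + Real.exp (c * t))) (semigroup L t f)) (Real.exp (c * t))
    * _).trace.re = Y
  generalize Real.exp (c * t) = x at *
  generalize weightedTrace σ (1 + x) (semigroup L t f) = W at *
  generalize relEnt σ (1 + x) (semigroup L t f) = R
  field_simp
  ring

/-- Hypercontractivity makes the right derivative at time zero of the norm along the semigroup
nonpositive, which is the logarithmic Sobolev inequality. -/
theorem IsHypercontractive.satisfiesLSWith (hL : IsLiouvillian L) (hσ : σ.PosDef)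
    (hσ1 : σ.trace = 1) {α : ℝ} (hα : 0 < α) (h : IsHypercontractive L σ (2 * α)) :
    SatisfiesLSWith L σ 2 α := by
  refine ⟨hα, fun f hf => ?_⟩
  have hd := hasDerivAt_log_lpNorm_semigroup hL hσ hσ1 hf (2 * α) le_rfl
  have hslope := hd.hasDerivWithinAt (s := Set.Ioi 0)
  rw [hasDerivWithinAt_iff_tendsto_slope' (by simp)] at hslope
  have hle := le_of_tendsto hslope (b := 0) (by
    filter_upwards [self_mem_nhdsWithin] with t ht
    rw [Set.mem_Ioi] at ht
    rw [slope_def_field, mul_zero, Real.exp_zero, one_add_one_eq_two, semigroup_zero, sub_zero]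
    refine div_nonpos_of_nonpos_of_nonneg (sub_nonpos.2 ?_) ht.le
    refine Real.log_le_log (lpNorm_pos hσ hσ1 _ (semigroup_posDef hL hf ht.le)) ?_
    refine h t ht _ ?_ le_rfl f hf
    have := Real.one_le_exp (show 0 ≤ 2 * α * t by positivity)
    linarith)
  rw [mul_zero, Real.exp_zero, one_add_one_eq_two, semigroup_zero, one_mul] at hle
  have hW := weightedTrace_pos hσ hσ1 2 hf
  rw [div_le_iff₀ (by positivity), zero_mul] at hle
  linarith

/-- Logarithmic Sobolev inequalities for all exponents `p ≥ 2` with a common constant imply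
hypercontractivity. -/
theorem isHypercontractive_of_forall_relEnt_le (hL : IsLiouvillian L) (hσ : σ.PosDef)
    (hσ1 : σ.trace = 1) {a : ℝ}
    (h : ∀ p : ℝ, 2 ≤ p → ∀ f : Mat d, f.PosDef → a * relEnt σ p f ≤ 2 * dirichlet L σ p f) :
    IsHypercontractive L σ a := by
  intro t ht p hp2 hpt f hf
  -- the rate that reaches the exponent `p` exactly at time `t`
  set c : ℝ := Real.log (p - 1) / t with hc
  have hc0 : 0 ≤ c := div_nonneg (Real.log_nonneg (by linarith)) ht.le
  have hca : c ≤ a := by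
    rw [hc, div_le_iff₀ ht, Real.log_le_iff_le_exp (by linarith)]
    linarith
  have hcp : 1 + Real.exp (c * t) = p := by
    rw [hc, div_mul_cancel₀ _ ht.ne', Real.exp_log (by linarith)]
    ring
  have hanti : AntitoneOn (fun s => Real.log (lpNorm σ (1 + Real.exp (c * s)) (semigroup L s f)))
      (Set.Icc 0 t) := by
    refine antitoneOn_of_deriv_nonpos (convex_Icc 0 t)
      (fun s hs => (hasDerivAt_log_lpNorm_semigroup hL hσ hσ1 hf c
        hs.1).continuousAt.continuousWithinAt) ?_ ?_
    all_goals
      rw [interior_Icc]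
      intro s hs
    · exact (hasDerivAt_log_lpNorm_semigroup hL hσ hσ1 hf c
        hs.1.le).differentiableAt.differentiableWithinAt
    · rw [(hasDerivAt_log_lpNorm_semigroup hL hσ hσ1 hf c hs.1.le).deriv]
      have hfs := semigroup_posDef hL hf hs.1.le
      have hq : 2 ≤ 1 + Real.exp (c * s) := by
        have := Real.one_le_exp (mul_nonneg hc0 hs.1.le)
        linarith
      have hW := weightedTrace_pos hσ hσ1 (1 + Real.exp (c * s)) hfs
      have h1 := mul_le_mul_of_nonneg_right hca
        (relEnt_nonneg hσ hσ1 (show 1 < 1 + Real.exp (c * s) by linarith) hfs)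
      have h2 := h _ hq _ hfs
      exact div_nonpos_of_nonpos_of_nonneg
        (mul_nonpos_of_nonneg_of_nonpos (Real.exp_pos _).le (by linarith)) (by positivity)
  have hle := hanti (Set.left_mem_Icc.2 ht.le) (Set.right_mem_Icc.2 ht.le) ht.le
  simp only [hcp, mul_zero, Real.exp_zero, one_add_one_eq_two, semigroup_zero] at hle
  exact (Real.log_le_log_iff (lpNorm_pos hσ hσ1 _ (semigroup_posDef hL hf ht.le))
    (lpNorm_pos hσ hσ1 _ hf)).1 hle

/-- Weak regularity gives `E_p ≥ a p / (2 (p - 1)) Ent_p`, and the factor `p / (p - 1)` is dropped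
because the entropy is nonnegative. -/
lemma IsWeaklyRegular.relEnt_le (hσ : σ.PosDef) (hσ1 : σ.trace = 1) (h : IsWeaklyRegular L σ)
    {a : ℝ} (hLS : SatisfiesLSWith L σ 2 a) {p : ℝ} (hp : 2 ≤ p) {f : Mat d} (hf : f.PosDef) :
    a * relEnt σ p f ≤ 2 * dirichlet L σ p f := by
  have h1 := (h p f hf).2 hp
  have h2 := hLS.2 _ (powOp_posDef hσ 2 p hf)
  rw [relEnt_two_powOp hσ hσ1 (by linarith) hf] at h2
  have h3 := relEnt_nonneg hσ hσ1 (by linarith : 1 < p) hf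
  have hp1 : 0 < p - 1 := by linarith
  rw [inv_mul_le_iff₀ hp1] at h1
  have h4 : 0 ≤ a * relEnt σ p f := mul_nonneg hLS.1.le h3
  refine le_of_mul_le_mul_left ?_ hp1
  nlinarith

lemma IsStronglyRegular.relEnt_le (hσ : σ.PosDef) (hσ1 : σ.trace = 1)
    (h : IsStronglyRegular L σ) {a : ℝ} (hLS : SatisfiesLSWith L σ 2 a) {p : ℝ} (hp : 2 ≤ p)
    {f : Mat d} (hf : f.PosDef) : 2 * a * relEnt σ p f ≤ 2 * dirichlet L σ p f := by
  have hp0 : 0 < p := by linarith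
  have h1 := h p (by linarith) f hf
  have h2 := hLS.2 _ (powOp_posDef hσ 2 p hf)
  rw [relEnt_two_powOp hσ hσ1 (by linarith) hf] at h2
  have h3 := mul_le_mul_of_nonneg_left h2 (show 0 ≤ 2 / p by positivity)
  have h4 : 2 / p * (a * (p / 2 * relEnt σ p f)) = a * relEnt σ p f := by field_simp
  linarith

end LogNorm

end

theorem theorem3p3 (d : ℕ) (L : Mat d →ₗ[ℂ] Mat d) (σ : Mat d)
    (hL : IsLiouvillian L) (hprim : IsPrimitiveWith L σ) :
    (∀ α : ℝ, 0 < α → IsHypercontractive L σ (2 * α) →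
      SatisfiesLSWith L σ 2 α ∧ (α : EReal) ≤ logSobolevConstant L σ 2) ∧
    (∀ α₂ : ℝ, SatisfiesLSWith L σ 2 α₂ →
      (IsWeaklyRegular L σ → IsHypercontractive L σ α₂) ∧
      (IsStronglyRegular L σ → IsHypercontractive L σ (2 * α₂))) := by
  obtain ⟨⟨-, hσ1⟩, hσ, -, -⟩ := hprim
  refine ⟨fun α hα h => ?_, fun α₂ hLS => ⟨fun h => ?_, fun h => ?_⟩⟩
  · have hLS := h.satisfiesLSWith hL hσ hσ1 hα
    exact ⟨hLS, le_sSup ⟨α, hLS, rfl⟩⟩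
  · exact isHypercontractive_of_forall_relEnt_le hL hσ hσ1
      fun p hp f hf => h.relEnt_le hσ hσ1 hLS hp hf
  · exact isHypercontractive_of_forall_relEnt_le hL hσ hσ1
      fun p hp f hf => h.relEnt_le hσ hσ1 hLS hp hf
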